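/- Let $n\ge 0$, $T>0$, and let $v=(v_1,\dots,v_n):\mathbb R\times\mathbb R^n\times\mathbb R^n\to\mathbb R^n$, $(t,x,y)\mapsto v(t,x,y)$, be infinitely smooth and $T$-periodic in $t$. Consider the system $$\ddot x_j = v_j(t,x,\dot x),\qquad j=1,\dots,n. \tag{1}$$ Suppose there are infinitely smooth $T$-periodic functions $x_1^j,x_2^j:\mathbb R\to\mathbb R$ $(1\le j\le n)$ such that for all $t\in\mathbb R$ and all $j$: 1. $x_1^j(t)<x_2^j(t)$; 2. $\ddot x_1^j(t)>v_j(t,x,y)$ for all $x,y\in\mathbb R^n$ with $x_i\in[x_1^i(t),x_2^i(t)]$ for every $i$, $x_j=x_1^j(t)$ and $y_j=\dot x_1^j(t)$ (the velocities $y_i$, $i\ne j$, being arbitrary); 3. $\ddot x_2^j(t)<v_j(t,x,y)$ for all $x,y\in\mathbb R^n$ with $x_i\in[x_1^i(t),x_2^i(t)]$ for every $i$, $x_j=x_2^j(t)$ and $y_j=\dot x_2^j(t)$ (the velocities $y_i$, $i\ne j$, being arbitrary). Suppose also that there are real constants $a,b$ and $\delta>0$ such that, with the Euclidean norm, $\|v(t,x,y)\|\le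 a+b\|y\|^{2-\delta}$ for all $t\in\mathbb R$ and $x,y\in\mathbb R^n$ with $y\neq 0$. Then the system (1) has a $T$-periodic solution $x=(x_1,\dots,x_n):\mathbb R\to\mathbb R^n$ such that $x_1^j(t)<x_j(t)<x_2^j(t)$ for every $j$ and all $t\in\mathbb R$. -/

import Mathlib

open scoped ContDiff

/-- `x` is a (twice differentiable, everywhere defined) solution of the second order system
`x'' = v (t, x, x')` in `ℝⁿ`. -/
def IsSecondOrderSolution {n : ℕ}
    (v : ℝ → EuclideanSpace ℝ (Fin n) → EuclideanSpace ℝ (Fin n) → EuclideanSpace ℝ (Fin n))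
    (x : ℝ → EuclideanSpace ℝ (Fin n)) : Prop :=
  ∀ t : ℝ, DifferentiableAt ℝ x t ∧ HasDerivAt (deriv x) (v t (x t) (deriv x t)) t

/-! Replace `v` by `w`, which clamps the position into the box between `x₁` and `x₂` and each
velocity coordinate into `[-R, R]`, and solve `x'' = x - π(t,x) + w(t,x,x')`, where `π` is the
clamped position. This is `x'' = x + g` with `g` bounded and Lipschitz. In the coordinates `x ± x'`
it is a saddle, expanding or contracting far out in each coordinate, so a Poincaré–Miranda argument
for the time-`T` map gives a periodic solution (`exists_periodic_solution_second_order`). Both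
truncations turn out to be inactive. If `x j - x₂ j` had a nonnegative maximum, its second
derivative there would be positive by the strict inequality for `x₂` (`neg_of_second_deriv_pos`);
the same holds for `x₁`. Then `|x''| ≤ Q`, and a Landau inequality gives `x'^2 ≤ 8 M Q`
coordinatewise. Subquadratic growth allows `R` with `8 M Q < R ^ 2` (`exists_truncation_level`).
Poincaré–Miranda itself rests on an analytic substitute for degree theory,
`exists_add_eq_zero_of_hasCompactSupport`: an integral that is polynomial in the homotopy parameter
and constant for small parameters is constant. -/

/-! ### Zeros of `C¹` maps that are the identity off a compact set. -/

open MeasureTheory in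
/-- If the integrals of a family of polynomials of bounded degree agree at all small positive
arguments, the same value is taken at every argument. -/
lemma integral_eval_eq_of_forall_small {X : Type*} [MeasurableSpace X] {μ : Measure X}
    (p : X → Polynomial ℝ) (d : ℕ) (hd : ∀ x, (p x).natDegree ≤ d)
    (hint : ∀ t : ℝ, Integrable (fun x => (p x).eval t) μ) {t₀ V : ℝ} (ht₀ : 0 < t₀)
    (hV : ∀ t, 0 < t → t < t₀ → ∫ x, (p x).eval t ∂μ = V) (s : ℝ) :
    ∫ x, (p x).eval s ∂μ = V := by
  -- Interpolating at `d + 1` distinct points of `(0, t₀)` gives weights independent of `x` with sum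
  -- one; the 2 keeps even the first node below `t₀`.
  let node : ℕ → ℝ := fun i => t₀ / (i + 2)
  have hnode : Set.InjOn node (Finset.range (d + 1)) := by
    intro i _ j _ h
    have hi : (0 : ℝ) < i + 2 := by positivity
    have hj : (0 : ℝ) < j + 2 := by positivity
    simp only [node] at h
    rw [div_eq_div_iff hi.ne' hj.ne'] at h
    have := mul_left_cancel₀ ht₀.ne' h
    exact_mod_cast (add_right_cancel this).symm
  have hpos : ∀ i, 0 < node i := fun i => by simp only [node]; positivity
  have hlt : ∀ i, node i < t₀ := fun i => by
    simp only [node]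
    rw [div_lt_iff₀ (by positivity)]
    have : (0 : ℝ) ≤ i := by positivity
    nlinarith
  have key : ∀ x, (p x).eval s = ∑ i ∈ Finset.range (d + 1),
      (Lagrange.basis (Finset.range (d + 1)) node i).eval s * (p x).eval (node i) := by
    intro x
    have hdeg : (p x).degree < (Finset.range (d + 1)).card := by
      rw [Finset.card_range]
      exact lt_of_le_of_lt Polynomial.degree_le_natDegree
        (by exact_mod_cast Nat.lt_succ_of_le (hd x))
    conv_lhs => rw [Lagrange.eq_interpolate hnode hdeg]
    rw [Lagrange.interpolate_apply, Polynomial.eval_finsetSum]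
    refine Finset.sum_congr rfl fun i _ => ?_
    rw [Polynomial.eval_mul, Polynomial.eval_C, mul_comm]
  simp_rw [key]
  rw [integral_finsetSum _ fun i _ => (hint _).const_mul _]
  simp_rw [integral_const_mul, hV _ (hpos _) (hlt _)]
  rw [← Finset.sum_mul, ← Polynomial.eval_finsetSum,
    Lagrange.sum_basis hnode ⟨0, by simp⟩, Polynomial.eval_one, one_mul]

/-- The polynomial `t ↦ (1 - c ‖x + t y‖ ^ 2) ^ k * det (1 + t A)`. -/
lemma exists_polynomial_eval_eq_mul_det {E : Type*} [NormedAddCommGroup E] [InnerProductSpace ℝ E]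
    [FiniteDimensional ℝ E] (c : ℝ) (k : ℕ) (x y : E) (A : E →L[ℝ] E) :
    ∃ p : Polynomial ℝ, p.natDegree ≤ 2 * k + Module.finrank ℝ E ∧
      ∀ t : ℝ, p.eval t = (1 - c * ‖x + t • y‖ ^ 2) ^ k *
        (ContinuousLinearMap.id ℝ E + t • A).det := by
  classical
  let b := Module.finBasis ℝ E
  let M := LinearMap.toMatrix b b A.toLinearMap
  let q : Polynomial ℝ := .C (1 - c * ‖x‖ ^ 2) + .C (-(2 * c * inner ℝ x y)) * .X
    + .C (-(c * ‖y‖ ^ 2)) * .X ^ 2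
  let r : Polynomial ℝ := ((Polynomial.X : Polynomial ℝ) • M.map Polynomial.C
    + (1 : Matrix _ _ ℝ).map Polynomial.C).det
  refine ⟨q ^ k * r, ?_, fun t => ?_⟩
  · have hq : q.natDegree ≤ 2 := by simp only [q]; compute_degree
    have hr : r.natDegree ≤ Module.finrank ℝ E := by
      simpa [r] using Polynomial.natDegree_det_X_add_C_le M 1
    calc (q ^ k * r).natDegree ≤ (q ^ k).natDegree + r.natDegree := Polynomial.natDegree_mul_le
      _ ≤ 2 * k + Module.finrank ℝ E := by
        gcongr
        calc (q ^ k).natDegree ≤ k * q.natDegree := Polynomial.natDegree_pow_le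
          _ ≤ k * 2 := by gcongr
          _ = 2 * k := by ring
  · have hq : q.eval t = 1 - c * ‖x + t • y‖ ^ 2 := by
      rw [norm_add_sq_real, norm_smul, inner_smul_right, mul_pow, Real.norm_eq_abs, sq_abs]
      simp only [q, Polynomial.eval_add, Polynomial.eval_mul, Polynomial.eval_C, Polynomial.eval_X,
        Polynomial.eval_pow]
      ring
    have hr : r.eval t = (ContinuousLinearMap.id ℝ E + t • A).det := by
      have h1 : (ContinuousLinearMap.id ℝ E + t • A).det = (t • M + 1).det := by
        rw [ContinuousLinearMap.det, ← LinearMap.det_toMatrix b]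
        congr 1
        rw [add_comm]
        simp [M, map_add, map_smul]
      rw [h1, ← Polynomial.coe_evalRingHom, RingHom.map_det]
      congr 1
      ext i j
      by_cases h : i = j
      · subst h; simp; ring
      · simp [h]; ring
    rw [Polynomial.eval_mul, Polynomial.eval_pow, hq, hr]

open MeasureTheory Metric Set in
/-- Perturbing the identity by a small multiple of a compactly supported `C¹` map does not change
integrals over a ball which contains the support. -/
lemma exists_forall_setIntegral_comp_mul_det_eq {E : Type*} [NormedAddCommGroup E]
    [InnerProductSpace ℝ E] [FiniteDimensional ℝ E] [MeasurableSpace E] [BorelSpace E]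
    {g : E → E} (hg : ContDiff ℝ 1 g) (hgs : HasCompactSupport g) {R : ℝ}
    (hR : ∀ x, x ∉ closedBall (0 : E) R → g x = 0) :
    ∃ t₀ : ℝ, 0 < t₀ ∧ ∀ t, 0 < t → t < t₀ → ∀ φ : E → ℝ,
      ∫ x in closedBall (0 : E) R, φ (x + t • g x) *
        (ContinuousLinearMap.id ℝ E + t • fderiv ℝ g x).det = ∫ x in closedBall (0 : E) R, φ x := by
  obtain ⟨L, hL⟩ := hg.lipschitzWith_of_hasCompactSupport hgs one_ne_zero
  have hdet : ∀ᶠ B : E →L[ℝ] E in nhds 0, 0 < (ContinuousLinearMap.id ℝ E + B).det := by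
    have hc : Continuous fun B : E →L[ℝ] E => (ContinuousLinearMap.id ℝ E + B).det :=
      ContinuousLinearMap.continuous_det.comp (continuous_const.add continuous_id)
    refine hc.continuousAt.eventually (lt_mem_nhds ?_)
    simp [ContinuousLinearMap.det]
  obtain ⟨η, hη, hdet⟩ := Metric.eventually_nhds_iff.1 hdet
  -- `t * L < η` keeps the determinant positive, and `t * L < 1` makes the map a bijection, being a
  -- contractive perturbation of the identity. The `+ 1` covers `L = 0`.
  refine ⟨min η 1 / (L + 1), by positivity, fun t ht htt φ => ?_⟩
  rw [lt_div_iff₀ (by positivity)] at htt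
  have htL : t * L < min η 1 := by nlinarith
  have hderiv : ∀ x, HasFDerivAt (fun x => x + t • g x)
      (ContinuousLinearMap.id ℝ E + t • fderiv ℝ g x) x := fun x =>
    (hasFDerivAt_id x).add (((hg.differentiable one_ne_zero) x).hasFDerivAt.const_smul t)
  have hpos : ∀ x, 0 < (ContinuousLinearMap.id ℝ E + t • fderiv ℝ g x).det := by
    intro x
    apply hdet
    rw [dist_zero_right, norm_smul, Real.norm_of_nonneg ht.le]
    exact (mul_le_mul_of_nonneg_left (norm_fderiv_le_of_lipschitz ℝ hL) ht.le).trans_lt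
      (htL.trans_le (min_le_left _ _))
  have happrox : ApproximatesLinearOn (fun x => x + t • g x)
      ((ContinuousLinearEquiv.refl ℝ E : E ≃L[ℝ] E) : E →L[ℝ] E) univ (t.toNNReal * L) := by
    intro x _ y _
    have h := hL.dist_le_mul x y
    have h1 : x + t • g x - (y + t • g y) - (x - y) = t • (g x - g y) := by
      rw [smul_sub]; abel
    simp only [dist_eq_norm, ContinuousLinearEquiv.coe_refl, ContinuousLinearMap.coe_id', id_eq,
      NNReal.coe_mul, Real.coe_toNNReal _ ht.le] at h ⊢
    rw [h1, norm_smul, Real.norm_of_nonneg ht.le, mul_assoc]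
    gcongr
  have hc : Subsingleton E ∨ t.toNNReal * L <
      ‖((ContinuousLinearEquiv.refl ℝ E).symm : E →L[ℝ] E)‖₊⁻¹ := by
    rcases subsingleton_or_nontrivial E with h | h
    · exact Or.inl h
    · refine Or.inr ?_
      have h1 : ‖((ContinuousLinearEquiv.refl ℝ E).symm : E →L[ℝ] E)‖₊ = 1 := by
        ext; simp
      rw [h1, inv_one, ← NNReal.coe_lt_coe]
      push_cast
      rw [Real.coe_toNNReal _ ht.le]
      exact htL.trans_le (min_le_right _ _)
  have hinj : Function.Injective fun x => x + t • g x := fun x y h =>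
    congrArg Subtype.val (happrox.injective hc (a₁ := ⟨x, trivial⟩) (a₂ := ⟨y, trivial⟩) h)
  have hsurj : Function.Surjective fun x => x + t • g x := happrox.surjective hc
  have hout : ∀ x, x ∉ closedBall (0 : E) R → x + t • g x = x := fun x hx => by simp [hR x hx]
  -- A bijection fixing every point outside the ball maps the ball onto itself.
  have himage : (fun x => x + t • g x) '' closedBall (0 : E) R = closedBall (0 : E) R := by
    ext y
    constructor
    · rintro ⟨x, hx, rfl⟩
      by_contra hy
      have h : x + t • g x = x := hinj (hout _ hy)
      exact hy (by simpa only [h] using hx)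
    · intro hy
      obtain ⟨x, rfl⟩ := hsurj y
      by_contra hx
      have hxb : x ∉ closedBall (0 : E) R := fun h => hx ⟨x, h, rfl⟩
      simp only [hout x hxb] at hy
      exact hxb hy
  have h := integral_image_eq_integral_abs_det_fderiv_smul volume
    (measurableSet_closedBall (x := (0 : E)) (ε := R))
    (fun x _ => (hderiv x).hasFDerivWithinAt) hinj.injOn φ
  rw [himage] at h
  rw [h]
  refine integral_congr_ae (Filter.Eventually.of_forall fun x => ?_)
  simp only [abs_of_pos (hpos x), smul_eq_mul, mul_comm]

open MeasureTheory Metric Set in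
/-- A `C¹` map of a Euclidean space which is the identity off a compact set takes the value `0`. -/
theorem exists_add_eq_zero_of_hasCompactSupport {E : Type*} [NormedAddCommGroup E]
    [InnerProductSpace ℝ E] [FiniteDimensional ℝ E]
    {g : E → E} (hg : ContDiff ℝ 1 g) (hgs : HasCompactSupport g) : ∃ x, x + g x = 0 := by
  borelize E
  by_contra! hne
  obtain ⟨R, hR0, hR⟩ : ∃ R : ℝ, 0 < R ∧ ∀ x, x ∉ closedBall (0 : E) R → g x = 0 := by
    obtain ⟨R, hR⟩ := hgs.isCompact.isBounded.subset_closedBall (0 : E)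
    refine ⟨max R 1, by positivity, fun x hx => ?_⟩
    by_contra h
    exact hx (closedBall_subset_closedBall (le_max_left _ _) (hR (subset_tsupport _ h)))
  have hcomp : IsCompact (closedBall (0 : E) R) := isCompact_closedBall _ _
  have hcont : Continuous fun x => ‖x + g x‖ := (continuous_id.add hg.continuous).norm
  obtain ⟨x₀, hx₀, hmin⟩ := hcomp.exists_isMinOn ⟨0, by simp [hR0.le]⟩ hcont.continuousOn
  obtain ⟨x₁, hx₁, hmax⟩ := hcomp.exists_isMaxOn ⟨0, by simp [hR0.le]⟩ hcont.continuousOn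
  set ε := min ‖x₀ + g x₀‖ R
  have hε : 0 < ε := lt_min (norm_pos_iff.2 (hne x₀)) hR0
  set M := max ‖x₁ + g x₁‖ R
  have hM : 0 < M := hR0.trans_le (le_max_right _ _)
  have hlow : ∀ x ∈ closedBall (0 : E) R, ε ≤ ‖x + g x‖ := fun x hx =>
    (min_le_left _ _).trans (hmin hx)
  have hup : ∀ x ∈ closedBall (0 : E) R, ‖x + g x‖ ≤ M := fun x hx =>
    (show ‖x + g x‖ ≤ ‖x₁ + g x₁‖ from hmax hx).trans (le_max_left _ _)
  -- `M` bounds both `‖x‖` and `‖x + g x‖` on the ball, so the bases of the `k`-th powers below lie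
  -- in `[0, 1]`.
  set c := 1 / M ^ 2
  have hc : 0 < c := by positivity
  have hcle : ∀ r, 0 ≤ r → r ≤ M → c * r ^ 2 ≤ 1 := by
    intro r hr hrM
    simp only [c]
    rw [one_div, inv_mul_le_iff₀ (by positivity), mul_one]
    gcongr
  have hcontdet : Continuous fun x =>
      (ContinuousLinearMap.id ℝ E + (1 : ℝ) • fderiv ℝ g x).det :=
    ContinuousLinearMap.continuous_det.comp
      (continuous_const.add ((hg.continuous_fderiv one_ne_zero).const_smul (1 : ℝ)))
  obtain ⟨D, hD⟩ := hcomp.exists_bound_of_continuousOn hcontdet.continuousOn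
  obtain ⟨t₀, ht₀, hsmall⟩ := exists_forall_setIntegral_comp_mul_det_eq hg hgs hR
  have hkey : ∀ k : ℕ, ∫ x in closedBall (0 : E) R, (1 - c * ‖x + (1 : ℝ) • g x‖ ^ 2) ^ k *
      (ContinuousLinearMap.id ℝ E + (1 : ℝ) • fderiv ℝ g x).det
      = ∫ x in closedBall (0 : E) R, (1 - c * ‖x‖ ^ 2) ^ k := by
    intro k
    choose p hpd hp using fun x => exists_polynomial_eval_eq_mul_det c k x (g x) (fderiv ℝ g x)
    simp_rw [← hp]
    refine integral_eval_eq_of_forall_small p _ hpd (fun t => ?_) ht₀ (fun t ht htt => ?_) 1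
    · simp_rw [hp]
      refine ContinuousOn.integrableOn_compact hcomp (Continuous.continuousOn ?_)
      refine Continuous.mul ?_ (ContinuousLinearMap.continuous_det.comp
        (continuous_const.add ((hg.continuous_fderiv one_ne_zero).const_smul t)))
      have := hg.continuous
      fun_prop
    · simp_rw [hp]
      exact hsmall t ht htt fun y => (1 - c * ‖y‖ ^ 2) ^ k
  set V := volume.real (closedBall (0 : E) R)
  set W := volume.real (closedBall (0 : E) (ε / 2))
  have hW : 0 < W := by
    refine ENNReal.toReal_pos (measure_closedBall_pos _ _ (by positivity)).ne' ?_
    exact (isCompact_closedBall _ _).measure_lt_top.ne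
  set α := 1 - c * ε ^ 2
  set β := 1 - c * (ε / 2) ^ 2
  have hεM : ε ≤ M := (min_le_right _ _).trans (le_max_right _ _)
  have hα : 0 ≤ α := sub_nonneg.2 (hcle ε hε.le hεM)
  have hαβ : α < β := by
    simp only [α, β]
    have : 0 < c * ε ^ 2 := by positivity
    nlinarith
  -- The integral at parameter 0 is at least the contribution of the ball of radius `ε / 2`; at
  -- parameter 1 the integrand is at most `α ^ k * D`, since `x + g x` avoids the ball of radius
  -- `ε`. As `α < β`, large `k` is impossible.
  have hineq : ∀ k : ℕ, W * β ^ k ≤ V * D * α ^ k := by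
    intro k
    have h1 : W * β ^ k ≤ ∫ x in closedBall (0 : E) R, (1 - c * ‖x‖ ^ 2) ^ k := by
      have hint : IntegrableOn (fun x : E => (1 - c * ‖x‖ ^ 2) ^ k) (closedBall 0 R) :=
        ContinuousOn.integrableOn_compact hcomp (by fun_prop)
      have hsub : closedBall (0 : E) (ε / 2) ⊆ closedBall 0 R :=
        closedBall_subset_closedBall (by linarith [min_le_right ‖x₀ + g x₀‖ R])
      calc W * β ^ k = ∫ _ in closedBall (0 : E) (ε / 2), β ^ k := by
            rw [setIntegral_const, smul_eq_mul]
        _ ≤ ∫ x in closedBall (0 : E) (ε / 2), (1 - c * ‖x‖ ^ 2) ^ k := by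
            refine setIntegral_mono_on ?_ (hint.mono_set hsub) measurableSet_closedBall ?_
            · exact ContinuousOn.integrableOn_compact (isCompact_closedBall _ _) (by fun_prop)
            · intro x hx
              rw [mem_closedBall_zero_iff] at hx
              have : 0 ≤ β := hα.trans hαβ.le
              simp only [β] at this ⊢
              gcongr
        _ ≤ ∫ x in closedBall (0 : E) R, (1 - c * ‖x‖ ^ 2) ^ k := by
            refine setIntegral_mono_set hint ?_ hsub.eventuallyLE
            refine (ae_restrict_iff' measurableSet_closedBall).2 (.of_forall fun x hx => ?_)
            rw [mem_closedBall_zero_iff] at hx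
            exact pow_nonneg (sub_nonneg.2
              (hcle _ (norm_nonneg _) (hx.trans (le_max_right _ _)))) _
    have h2 : ∫ x in closedBall (0 : E) R, (1 - c * ‖x + (1 : ℝ) • g x‖ ^ 2) ^ k *
        (ContinuousLinearMap.id ℝ E + (1 : ℝ) • fderiv ℝ g x).det ≤ α ^ k * D * V := by
      refine (Real.le_norm_self _).trans
        (norm_setIntegral_le_of_norm_le_const hcomp.measure_lt_top fun x hx => ?_)
      rw [one_smul, norm_mul, norm_pow]
      have h3 : ‖1 - c * ‖x + g x‖ ^ 2‖ ≤ α := by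
        rw [Real.norm_of_nonneg (sub_nonneg.2 (hcle _ (norm_nonneg _) (hup x hx)))]
        have := hlow x hx
        simp only [α]
        gcongr
      have := hD x hx
      gcongr
    rw [hkey] at h2
    linarith
  have hβ : 0 < β := hα.trans_lt hαβ
  have hlim : Filter.Tendsto (fun k : ℕ => V * D * (α / β) ^ k) Filter.atTop (nhds (V * D * 0)) :=
    (tendsto_pow_atTop_nhds_zero_of_lt_one (by positivity) ((div_lt_one hβ).2 hαβ)).const_mul _
  have hle : W ≤ V * D * 0 := ge_of_tendsto' hlim fun k => by
    rw [div_pow, ← mul_div_assoc, le_div_iff₀ (by positivity)]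
    exact hineq k
  linarith

/-! ### Poincaré–Miranda. -/

lemma EuclideanSpace.norm_le_sqrt_card_mul {ι : Type*} [Fintype ι] {x : EuclideanSpace ℝ ι} {M : ℝ}
    (hM : 0 ≤ M) (hx : ∀ i, |x i| ≤ M) : ‖x‖ ≤ √(Fintype.card ι) * M := by
  rw [EuclideanSpace.norm_eq]
  calc √(∑ i, ‖x i‖ ^ 2) ≤ √(∑ _i : ι, M ^ 2) := by
        gcongr with i
        exact hx i
    _ = √(Fintype.card ι) * M := by
        rw [Finset.sum_const, nsmul_eq_mul, Real.sqrt_mul (by positivity), Real.sqrt_sq hM,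
          Finset.card_univ]

open scoped Manifold in
/-- A version of the **Poincaré–Miranda theorem** for maps of a whole Euclidean space. -/
theorem exists_eq_zero_of_forall_sign {ι : Type*} [Fintype ι]
    {G : EuclideanSpace ℝ ι → EuclideanSpace ℝ ι} (hG : Continuous G) {K : ℝ} (hK : 0 < K)
    (hpos : ∀ z i, K ≤ z i → 0 < G z i) (hneg : ∀ z i, z i ≤ -K → G z i < 0) :
    ∃ z, G z = 0 := by
  by_contra! hne
  -- The ball excludes 0. A `C¹` selection of these convex sets smooths `G` while keeping it
  -- nonvanishing and its signs correct.
  let S : EuclideanSpace ℝ ι → Set (EuclideanSpace ℝ ι) := fun y =>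
    Metric.ball (G y) ‖G y‖ ∩ {w | ∀ i, (K ≤ y i → 0 < w i) ∧ (y i ≤ -K → w i < 0)}
  have hSconv : ∀ y, Convex ℝ (S y) := by
    refine fun y => (convex_ball _ _).inter ?_
    intro w hw w' hw' a b ha hb hab i
    have hcomb : (a • w + b • w') i = a * w i + b * w' i := by simp
    rw [hcomb]
    rcases eq_or_lt_of_le ha with rfl | ha
    · obtain rfl : b = 1 := by linarith
      simpa using hw' i
    · refine ⟨fun h => ?_, fun h => ?_⟩
      · have h1 := (hw i).1 h
        have h2 := (hw' i).1 h
        positivity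
      · have h1 := (hw i).2 h
        have h2 := (hw' i).2 h
        nlinarith
  have hloc : ∀ x, ∃ c, ∀ᶠ y in nhds x, c ∈ S y := by
    refine fun x => ⟨G x, ?_⟩
    have h1 : ∀ᶠ y in nhds x, G x ∈ Metric.ball (G y) ‖G y‖ := by
      have hc : Continuous fun y => ‖G y‖ - dist (G x) (G y) := by fun_prop
      filter_upwards [hc.continuousAt.eventually
        (lt_mem_nhds (a := 0) (by simpa using hne x))] with y hy
      exact sub_pos.1 hy
    have h2 : ∀ i, ∀ᶠ y : EuclideanSpace ℝ ι in nhds x,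
        (K ≤ y i → 0 < G x i) ∧ (y i ≤ -K → G x i < 0) := by
      intro i
      have hc : Continuous fun y : EuclideanSpace ℝ ι => y i := by fun_prop
      refine Filter.Eventually.and ?_ ?_
      · rcases le_or_gt K (x i) with h | h
        · exact .of_forall fun _ _ => hpos x i h
        · filter_upwards [hc.continuousAt.eventually (gt_mem_nhds h)] with y hy hy'
          exact absurd hy' (not_le.2 hy)
      · rcases le_or_gt (x i) (-K) with h | h
        · exact .of_forall fun _ _ => hneg x i h
        · filter_upwards [hc.continuousAt.eventually (lt_mem_nhds h)] with y hy hy'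
          exact absurd hy' (not_le.2 hy)
    filter_upwards [h1, Filter.eventually_all.2 h2] with y hy1 hy2
    exact ⟨hy1, hy2⟩
  obtain ⟨H, hH⟩ := exists_contMDiffMap_forall_mem_convex_of_local_const (n := 1)
    𝓘(ℝ, EuclideanSpace ℝ ι) hSconv hloc
  have hHsmooth : ContDiff ℝ 1 H := H.contMDiff.contDiff
  have hHne : ∀ y, H y ≠ 0 := by
    intro y h
    have := (hH y).1
    rw [h, Metric.mem_ball, dist_zero_left] at this
    exact lt_irrefl _ this
  -- The cutoff must be 1 on the cube of half-side `K`; the `+ 1` keeps `ρ` positive in dimension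
  -- zero.
  let ρ : ℝ := √(Fintype.card ι) * K + 1
  have hρ : 0 < ρ := by positivity
  let χ : ContDiffBump (0 : EuclideanSpace ℝ ι) := ⟨ρ, ρ + 1, hρ, by linarith⟩
  -- `z + χ z • (H z - z)` is `H` on the cube, and outside it a convex combination of `z` and `H z`,
  -- which share a strict sign in some coordinate. So it has no zero.
  obtain ⟨z, hz⟩ := exists_add_eq_zero_of_hasCompactSupport
    (g := fun z => χ z • (H z - z)) (χ.contDiff.smul (hHsmooth.sub contDiff_id))
    χ.hasCompactSupport.smul_right
  have hcomb : ∀ i, (1 - χ z) * z i + χ z * H z i = 0 := by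
    intro i
    have := congrArg (fun w : EuclideanSpace ℝ ι => w i) hz
    simp only [PiLp.add_apply, PiLp.smul_apply, PiLp.sub_apply, smul_eq_mul, PiLp.zero_apply]
      at this
    linarith
  by_cases hcube : ∀ i, |z i| ≤ K
  · have hmem : z ∈ Metric.closedBall (0 : EuclideanSpace ℝ ι) ρ := by
      rw [mem_closedBall_zero_iff]
      exact (EuclideanSpace.norm_le_sqrt_card_mul hK.le hcube).trans
        (le_add_of_nonneg_right zero_le_one)
    have h1 : χ z = 1 := χ.one_of_mem_closedBall hmem
    rw [h1] at hz
    exact hHne z (by simpa using hz)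
  · push Not at hcube
    obtain ⟨i, hi⟩ := hcube
    have h0 := χ.nonneg (x := z)
    have h1 := χ.le_one (x := z)
    have h2 := hcomb i
    have key : ∀ p q : ℝ, 0 < p → 0 < q → 0 < (1 - χ z) * p + χ z * q := by
      intro p q hp hq
      rcases eq_or_lt_of_le h0 with h | h
      · rw [← h]; linarith
      · nlinarith [mul_pos h hq, mul_nonneg (sub_nonneg.2 h1) hp.le]
    rcases lt_abs.1 hi with hi | hi
    · linarith [key _ _ (hK.trans hi) (((hH z).2 i).1 hi.le)]
    · have := key (-(z i)) (-(H z i)) (hK.trans hi)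
        (neg_pos.2 (((hH z).2 i).2 (by linarith)))
      linarith

/-! ### Flows and periodic solutions of first order systems. -/

open Set in
/-- Global existence for a bounded vector field which is Lipschitz in space. -/
lemma exists_forall_hasDerivAt_of_lipschitzWith {E : Type*} [NormedAddCommGroup E]
    [NormedSpace ℝ E] [CompleteSpace E] {F : ℝ → E → E} {L C : NNReal}
    (hL : ∀ t, LipschitzWith L (F t)) (hF : ∀ x, Continuous fun t => F t x)
    (hC : ∀ t x, ‖F t x‖ ≤ C) (x₀ : E) :
    ∃ α : ℝ → E, α 0 = x₀ ∧ ∀ t, HasDerivAt α (F t (α t)) t := by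
  have hloc : ∀ N : ℕ, ∃ α : ℝ → E, α 0 = x₀ ∧
      ∀ t ∈ Ioo (-(N + 1) : ℝ) (N + 1), HasDerivAt α (F t (α t)) t := by
    intro N
    have hN : (0 : ℝ) ≤ N := N.cast_nonneg
    -- With speed at most `C`, the ball of radius `C * (N + 1)` is not left within time `N + 1`.
    have hpl : IsPicardLindelof F (tmin := -(N + 1)) (tmax := N + 1)
        ⟨0, by constructor <;> linarith⟩ x₀ (C * (N + 1)) 0 C L := by
      refine ⟨fun t _ => (hL t).lipschitzOnWith, fun x _ => (hF x).continuousOn,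
        fun t _ x _ => hC t x, ?_⟩
      simp
    obtain ⟨α, h0, hα⟩ := hpl.exists_eq_forall_mem_Icc_hasDerivWithinAt₀
    exact ⟨α, h0, fun t ht => (hα t (Ioo_subset_Icc_self ht)).hasDerivAt
      (Icc_mem_nhds ht.1 ht.2)⟩
  choose β hβ0 hβ using hloc
  have hagree : ∀ N M : ℕ, N ≤ M → EqOn (β N) (β M) (Ioo (-(N + 1) : ℝ) (N + 1)) := by
    intro N M hNM
    have hN : (0 : ℝ) ≤ N := N.cast_nonneg
    have hNM' : (N : ℝ) ≤ M := by exact_mod_cast hNM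
    refine ODE_solution_unique_of_mem_Ioo (v := F) (s := fun _ => univ) (K := L) (t₀ := 0)
      (fun t _ => (hL t).lipschitzOnWith) (by constructor <;> linarith)
      (fun t ht => ⟨hβ N t ht, trivial⟩)
      (fun t ht => ⟨hβ M t ⟨by linarith [ht.1], by linarith [ht.2]⟩, trivial⟩)
      (by rw [hβ0, hβ0])
  have hmem : ∀ t : ℝ, t ∈ Ioo (-(⌈|t|⌉₊ + 1) : ℝ) (⌈|t|⌉₊ + 1) := by
    intro t
    have h1 := Nat.le_ceil |t|
    have h2 := abs_le.1 h1
    constructor <;> linarith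
  have hglue : ∀ (N : ℕ) (t : ℝ), t ∈ Ioo (-(N + 1) : ℝ) (N + 1) → β ⌈|t|⌉₊ t = β N t := by
    intro N t ht
    rcases le_total ⌈|t|⌉₊ N with h | h
    · exact hagree _ _ h (hmem t)
    · exact (hagree _ _ h ht).symm
  refine ⟨fun t => β ⌈|t|⌉₊ t, hβ0 _, fun t => ?_⟩
  refine (hβ _ t (hmem t)).congr_of_eventuallyEq ?_
  filter_upwards [isOpen_Ioo.mem_nhds (hmem t)] with s hs
  exact hglue _ s hs

open Set in
/-- Solutions of an ordinary differential equation with Lipschitz right hand side depend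
continuously on the initial value. -/
lemma continuous_of_forall_hasDerivAt_of_lipschitzWith {E : Type*} [NormedAddCommGroup E]
    [NormedSpace ℝ E] {F : ℝ → E → E} {L : NNReal} (hL : ∀ t, LipschitzWith L (F t))
    {Φ : E → ℝ → E} (h0 : ∀ z, Φ z 0 = z) (hΦ : ∀ z t, HasDerivAt (Φ z) (F t (Φ z t)) t)
    {T : ℝ} (hT : 0 ≤ T) : Continuous fun z => Φ z T := by
  have hlip : LipschitzWith (Real.exp (L * T)).toNNReal fun z => Φ z T := by
    refine LipschitzWith.of_dist_le_mul fun x y => ?_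
    have := dist_le_of_trajectories_ODE (v := F) (K := L) (a := 0) (b := T) (δ := dist x y)
      hL (f := Φ x) (g := Φ y) (fun t _ => (hΦ x t).continuousAt.continuousWithinAt)
      (fun t _ => (hΦ x t).hasDerivWithinAt) (fun t _ => (hΦ y t).continuousAt.continuousWithinAt)
      (fun t _ => (hΦ y t).hasDerivWithinAt) (by rw [h0, h0]) T ⟨hT, le_rfl⟩
    rw [sub_zero] at this
    rw [Real.coe_toNNReal _ (Real.exp_pos _).le]
    linarith
  exact hlip.continuous

/-- A periodic system `z' = F (t, z)` whose coordinates point outwards or inwards far away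
from the origin has a periodic solution. -/
theorem exists_periodic_solution_of_forall_sign {ι : Type*} [Fintype ι]
    {F : ℝ → (ι → ℝ) → ι → ℝ} {L C : NNReal} {T K : ℝ} (hT : 0 < T) (hK : 0 ≤ K) (s : ι → ℝ)
    (hL : ∀ t, LipschitzWith L (F t)) (hF : ∀ x, Continuous fun t => F t x)
    (hC : ∀ t x, ‖F t x‖ ≤ C) (hper : ∀ t x, F (t + T) x = F t x)
    (hpos : ∀ t z i, K ≤ z i → 0 < s i * F t z i)
    (hneg : ∀ t z i, z i ≤ -K → s i * F t z i < 0) :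
    ∃ z : ℝ → ι → ℝ, (∀ t, HasDerivAt z (F t (z t)) t) ∧ Function.Periodic z T := by
  choose Φ hΦ0 hΦ using exists_forall_hasDerivAt_of_lipschitzWith hL hF hC
  have hcont := continuous_of_forall_hasDerivAt_of_lipschitzWith hL hΦ0 hΦ hT.le
  have hcoord : ∀ z i t, HasDerivAt (fun t => Φ z t i) (F t (Φ z t) i) t := fun z i t =>
    hasDerivAt_pi.1 (hΦ z t) i
  have hFi : ∀ t z i, |F t z i| ≤ C := fun t z i => (norm_le_pi_norm (F t z) i).trans (hC t z)
  have hbound : ∀ z i t, 0 ≤ t → t ≤ T → |Φ z t i - z i| ≤ C * T := by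
    intro z i t ht htT
    have h := Convex.norm_image_sub_le_of_norm_hasDerivWithin_le (s := Set.univ) (C := (C : ℝ))
      (fun t _ => (hcoord z i t).hasDerivWithinAt) (fun t _ => hFi t _ i) convex_univ
      (Set.mem_univ 0) (Set.mem_univ t)
    rw [hΦ0, sub_zero, Real.norm_of_nonneg ht] at h
    exact h.trans (by gcongr)
  have hmvt : ∀ z i, ∃ c ∈ Set.Ioo 0 T, Φ z T i - z i = T * F c (Φ z c) i := by
    intro z i
    obtain ⟨c, hc, h⟩ := exists_hasDerivAt_eq_slope (fun t => Φ z t i) _ hT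
      (fun t _ => (hcoord z i t).continuousAt.continuousWithinAt) (fun t _ => hcoord z i t)
    refine ⟨c, hc, ?_⟩
    rw [h, hΦ0, sub_zero, mul_div_cancel₀ _ hT.ne']
  -- A coordinate moves by at most `C * T` in a period, so starting beyond `K + C * T` it stays
  -- beyond `K`, and the mean value theorem fixes the sign of its displacement. The `+ 1` makes the
  -- level positive when `K = 0`.
  obtain ⟨ζ, hζ⟩ := exists_eq_zero_of_forall_sign (ι := ι) (K := K + C * T + 1)
    (G := fun ζ => WithLp.toLp 2 fun i => s i * (Φ (WithLp.ofLp ζ) T i - ζ i))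
    (by fun_prop) (by positivity)
    (by
      intro ζ i hi
      obtain ⟨c, hc, h⟩ := hmvt ζ.ofLp i
      have hb := (abs_le.1 (hbound ζ.ofLp i c hc.1.le hc.2.le)).1
      have := mul_pos hT (hpos c (Φ ζ.ofLp c) i (by linarith))
      simp only [h]
      linarith)
    (by
      intro ζ i hi
      obtain ⟨c, hc, h⟩ := hmvt ζ.ofLp i
      have hb := (abs_le.1 (hbound ζ.ofLp i c hc.1.le hc.2.le)).2
      have := mul_neg_of_pos_of_neg hT (hneg c (Φ ζ.ofLp c) i (by linarith))
      simp only [h]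
      linarith)
  set z₀ : ι → ℝ := ζ.ofLp
  have hs : ∀ i, s i ≠ 0 := fun i h => by
    have := hpos 0 (fun _ => K) i le_rfl
    simp [h] at this
  have hret : Φ z₀ T = z₀ := by
    ext i
    have := congrArg (fun w : EuclideanSpace ℝ ι => w i) hζ
    simpa [hs i, sub_eq_zero] using this
  refine ⟨Φ z₀, hΦ z₀, fun t => ?_⟩
  have hshift : (fun t => Φ z₀ (t + T)) = Φ z₀ :=
    ODE_solution_unique_univ (v := F) (s := fun _ => Set.univ) (K := L) (t₀ := 0)
      (fun t => (hL t).lipschitzOnWith)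
      (fun t => ⟨by simpa only [hper] using (hΦ z₀ (t + T)).comp_add_const t T, trivial⟩)
      (fun t => ⟨hΦ z₀ t, trivial⟩) (by simp only [zero_add, hret, hΦ0])
  exact congrFun hshift t

/-! ### Truncation. -/

/-- Truncation of a real number to the interval `[a, b]`. -/
def clamp (a b x : ℝ) : ℝ := max a (min b x)

lemma le_clamp (a b x : ℝ) : a ≤ clamp a b x := le_max_left _ _

lemma clamp_le {a b : ℝ} (h : a ≤ b) (x : ℝ) : clamp a b x ≤ b := max_le h (min_le_left _ _)

lemma clamp_of_mem {a b x : ℝ} (ha : a ≤ x) (hb : x ≤ b) : clamp a b x = x := by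
  rw [clamp, min_eq_right hb, max_eq_right ha]

lemma clamp_of_ge {a b x : ℝ} (h : a ≤ b) (hx : b ≤ x) : clamp a b x = b := by
  rw [clamp, min_eq_left hx, max_eq_right h]

lemma clamp_of_le {a b x : ℝ} (h : a ≤ b) (hx : x ≤ a) : clamp a b x = a := by
  rw [clamp, min_eq_right (hx.trans h), max_eq_left hx]

lemma abs_clamp_sub_clamp_le (a b x y : ℝ) : |clamp a b x - clamp a b y| ≤ |x - y| := by
  unfold clamp
  grind

lemma abs_clamp_le {K : ℝ} (hK : 0 ≤ K) (x : ℝ) : |clamp (-K) K x| ≤ K :=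
  abs_le.2 ⟨le_clamp _ _ _, clamp_le (by linarith) _⟩

lemma abs_clamp_le_of_abs_le {a b M : ℝ} (h : a ≤ b) (ha : |a| ≤ M) (hb : |b| ≤ M) (x : ℝ) :
    |clamp a b x| ≤ M :=
  abs_le.2 ⟨(abs_le.1 ha).1.trans (le_clamp _ _ _), (clamp_le h _).trans (abs_le.1 hb).2⟩

lemma dist_pi_clamp_le {ι : Type*} [Fintype ι] (a b x y : ι → ℝ) :
    dist (fun i => clamp (a i) (b i) (x i)) (fun i => clamp (a i) (b i) (y i)) ≤ dist x y := by
  refine (dist_pi_le_iff dist_nonneg).2 fun i => ?_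
  exact (abs_clamp_sub_clamp_le _ _ _ _).trans (dist_le_pi_dist x y i)

/-! ### Maximum principle and Landau inequality. -/

/-- A continuous periodic function attains its maximum. -/
lemma Function.Periodic.exists_forall_le {f : ℝ → ℝ} {T : ℝ} (hf : Function.Periodic f T)
    (hT : 0 < T) (hc : Continuous f) : ∃ s, ∀ t, f t ≤ f s := by
  obtain ⟨s, _, hs⟩ := isCompact_Icc.exists_isMaxOn ⟨0, Set.left_mem_Icc.2 hT.le⟩ hc.continuousOn
  refine ⟨s, fun t => ?_⟩
  obtain ⟨r, hr, h⟩ := hf.exists_mem_Ico₀ hT t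
  rw [h]
  exact hs (Set.Ico_subset_Icc_self hr)

/-- Finitely many continuous periodic functions have a common bound. -/
lemma exists_forall_abs_le_of_periodic {ι : Type*} [Finite ι] {f : ι → ℝ → ℝ} {T : ℝ} (hT : 0 < T)
    (hf : ∀ i, Function.Periodic (f i) T) (hc : ∀ i, Continuous (f i)) :
    ∃ M, ∀ i t, |f i t| ≤ M := by
  choose s hs using fun i => Function.Periodic.exists_forall_le (f := fun t => |f i t|)
    (fun t => by simp only [hf i t]) hT (hc i).abs
  obtain ⟨M, hM⟩ := (Set.finite_range fun i => |f i (s i)|).bddAbove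
  exact ⟨M, fun i t => (hs i t).trans (hM ⟨i, rfl⟩)⟩

lemma deriv_periodic {f : ℝ → ℝ} {T : ℝ} (hf : Function.Periodic f T) :
    Function.Periodic (deriv f) T := fun t => by
  rw [← deriv_comp_add_const, funext hf]

/-- The necessary second order condition at a maximum. -/
lemma second_deriv_nonpos_of_forall_le {f f' : ℝ → ℝ} {c s : ℝ}
    (hf : ∀ t, HasDerivAt f (f' t) t) (hf' : HasDerivAt f' c s) (hs : ∀ t, f t ≤ f s) : c ≤ 0 := by
  by_contra! hc
  have hd : deriv f = f' := funext fun t => (hf t).deriv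
  have hmax : IsLocalMax f s := .of_forall hs
  -- A maximum that is also a local minimum makes `f` locally constant, contradicting `0 < c`.
  have hmin : IsLocalMin f s := isLocalMin_of_deriv_deriv_pos (by rwa [hd, hf'.deriv])
    hmax.deriv_eq_zero (hf s).continuousAt
  have hconst : f =ᶠ[nhds s] fun _ => f s := by
    filter_upwards [hmin] with t ht using le_antisymm (hs t) ht
  have h0 := hconst.deriv.deriv.eq_of_nhds
  rw [hd, hf'.deriv] at h0
  simp at h0
  linarith

/-- A maximum principle for periodic functions. -/
lemma neg_of_second_deriv_pos {f f' f'' : ℝ → ℝ} {T : ℝ} (hT : 0 < T)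
    (hf : ∀ t, HasDerivAt f (f' t) t) (hf' : ∀ t, HasDerivAt f' (f'' t) t)
    (hper : Function.Periodic f T) (h : ∀ t, 0 ≤ f t → f' t = 0 → 0 < f'' t) (t : ℝ) : f t < 0 := by
  obtain ⟨s, hs⟩ := hper.exists_forall_le hT
    (continuous_iff_continuousAt.2 fun t => (hf t).continuousAt)
  refine (hs t).trans_lt ?_
  by_contra! h0
  have hd : f' s = 0 := IsLocalMax.hasDerivAt_eq_zero (.of_forall hs) (hf s)
  exact absurd (second_deriv_nonpos_of_forall_le hf (hf' s) hs) (not_le.2 (h s h0 hd))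

/-- An inequality of Landau type: a bounded function with a bounded second derivative has a bounded
derivative. -/
lemma sq_deriv_le_of_abs_le {f f' f'' : ℝ → ℝ} {M Q : ℝ} (hQ : 0 < Q)
    (hf : ∀ t, HasDerivAt f (f' t) t) (hf' : ∀ t, HasDerivAt f' (f'' t) t)
    (hM : ∀ t, |f t| ≤ M) (hf'' : ∀ t, |f'' t| ≤ Q) (t : ℝ) : f' t ^ 2 ≤ 8 * M * Q := by
  have key : ∀ g g' g'' : ℝ → ℝ, (∀ t, HasDerivAt g (g' t) t) → (∀ t, HasDerivAt g' (g'' t) t) →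
      (∀ t, |g t| ≤ M) → (∀ t, |g'' t| ≤ Q) → 0 < g' t → g' t ^ 2 ≤ 8 * M * Q := by
    intro g g' g'' hg hg' hgM hgQ hpos
    -- During this time `g'` stays at least half its value at `t`, so `g` rises by at least `g' t ^
    -- 2 / (4 * Q)`, while it can rise by at most `2 * M`.
    set h := g' t / (2 * Q)
    have hh : 0 < h := by positivity
    have hhQ : Q * h = g' t / 2 := by simp only [h]; field_simp
    obtain ⟨c, hc, hslope⟩ := exists_hasDerivAt_eq_slope g g' (show t < t + h by linarith)
      (fun s _ => (hg s).continuousAt.continuousWithinAt) (fun s _ => hg s)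
    have hdiff := Convex.norm_image_sub_le_of_norm_hasDerivWithin_le (s := Set.univ) (C := Q)
      (fun s _ => (hg' s).hasDerivWithinAt) (fun s _ => hgQ s) convex_univ
      (Set.mem_univ t) (Set.mem_univ c)
    rw [Real.norm_eq_abs, Real.norm_of_nonneg (by linarith [hc.1])] at hdiff
    have h1 : Q * (c - t) ≤ g' t / 2 := by
      rw [← hhQ]; gcongr; linarith [hc.2]
    have h2 : g' t / 2 ≤ g' c := by linarith [(abs_le.1 hdiff).1]
    rw [hslope, add_sub_cancel_left, le_div_iff₀ hh] at h2
    have h3 : g' t / 2 * h ≤ 2 * M := by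
      linarith [(abs_le.1 (hgM (t + h))).2, (abs_le.1 (hgM t)).1]
    have h4 : g' t ^ 2 = 4 * Q * (g' t / 2 * h) := by
      simp only [h]; field_simp; ring
    rw [h4]
    nlinarith
  rcases lt_trichotomy (f' t) 0 with h | h | h
  · have := key (fun t => -f t) (fun t => -f' t) (fun t => -f'' t) (fun t => (hf t).neg)
      (fun t => (hf' t).neg) (by simpa using hM) (by simpa using hf'') (by simpa using h)
    simpa using this
  · have := (abs_nonneg _).trans (hM t)
    rw [h, zero_pow two_ne_zero]
    positivity
  · exact key f f' f'' hf hf' hM hf'' h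

/-! ### Second order systems with bounded perturbation. -/

/-- A second order system `x'' = x + g (t, x, x')` with bounded `g` has a periodic solution. -/
theorem exists_periodic_solution_second_order {ι : Type*} [Fintype ι]
    {g : ℝ → (ι → ℝ) → (ι → ℝ) → ι → ℝ} {L : NNReal} {T M : ℝ} (hT : 0 < T) (hM : 0 ≤ M)
    (hL : ∀ t x x' y y', dist (g t x y) (g t x' y') ≤ L * max (dist x x') (dist y y'))
    (hg : ∀ x y, Continuous fun t => g t x y) (hbound : ∀ t x y i, |g t x y i| ≤ M)
    (hper : ∀ t x y, g (t + T) x y = g t x y) :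
    ∃ x y : ℝ → ι → ℝ, Function.Periodic x T ∧ (∀ t i, HasDerivAt (fun t => x t i) (y t i) t) ∧
      ∀ t i, HasDerivAt (fun t => y t i) (x t i + g t (x t) (y t) i) t := by
  set K : ℝ := M + 1
  have hK : 0 < K := by positivity
  -- The coordinates are `x + y` on the left summand and `x - y` on the right; they satisfy `z' = s
  -- * (z + g)` with `s = 1` and `s = -1` respectively.
  let pos : (ι ⊕ ι → ℝ) → ι → ℝ := fun z i => (z (.inl i) + z (.inr i)) / 2
  let vel : (ι ⊕ ι → ℝ) → ι → ℝ := fun z i => (z (.inl i) - z (.inr i)) / 2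
  let idx : ι ⊕ ι → ι := Sum.elim id id
  let s : ι ⊕ ι → ℝ := Sum.elim (fun _ => 1) (fun _ => -1)
  have hs : ∀ i, s i * s i = 1 := by rintro (i | i) <;> simp [s]
  have hsabs : ∀ i, |s i| = 1 := by rintro (i | i) <;> simp [s]
  have hdpos : ∀ z z', dist (pos z) (pos z') ≤ dist z z' := fun z z' => by
    refine (dist_pi_le_iff dist_nonneg).2 fun i => ?_
    have h1 := abs_le.1 (dist_le_pi_dist z z' (.inl i))
    have h2 := abs_le.1 (dist_le_pi_dist z z' (.inr i))
    simp only [pos, Real.dist_eq]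
    exact abs_le.2 ⟨by linarith [h1.1, h2.1], by linarith [h1.2, h2.2]⟩
  have hdvel : ∀ z z', dist (vel z) (vel z') ≤ dist z z' := fun z z' => by
    refine (dist_pi_le_iff dist_nonneg).2 fun i => ?_
    have h1 := abs_le.1 (dist_le_pi_dist z z' (.inl i))
    have h2 := abs_le.1 (dist_le_pi_dist z z' (.inr i))
    simp only [vel, Real.dist_eq]
    exact abs_le.2 ⟨by linarith [h1.1, h2.2], by linarith [h1.2, h2.1]⟩
  -- Clamping at `K = M + 1` makes the field bounded without affecting its sign far out.
  let F : ℝ → (ι ⊕ ι → ℝ) → ι ⊕ ι → ℝ := fun t z i =>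
    s i * (clamp (-K) K (z i) + g t (pos z) (vel z) (idx i))
  have hsF : ∀ t z i, s i * F t z i = clamp (-K) K (z i) + g t (pos z) (vel z) (idx i) :=
    fun t z i => by simp only [F]; rw [← mul_assoc, hs, one_mul]
  obtain ⟨z, hz, hzper⟩ := exists_periodic_solution_of_forall_sign (F := F) (L := L + 1)
    (C := (K + M).toNNReal) hT hK.le s
    (by
      refine fun t => LipschitzWith.of_dist_le_mul fun z z' => ?_
      refine (dist_pi_le_iff (by positivity)).2 fun i => ?_
      have h1 := (abs_clamp_sub_clamp_le (-K) K (z i) (z' i)).trans (dist_le_pi_dist z z' i)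
      have h2 := (dist_le_pi_dist (g t (pos z) (vel z)) (g t (pos z') (vel z')) (idx i)).trans
        ((hL _ _ _ _ _).trans (mul_le_mul_of_nonneg_left (max_le (hdpos z z') (hdvel z z')) L.2))
      simp only [F, Real.dist_eq] at h2 ⊢
      rw [← mul_sub, abs_mul, hsabs, one_mul, add_sub_add_comm]
      refine (abs_add_le _ _).trans ?_
      push_cast
      change _ ≤ (L : ℝ) * dist z z' at h2
      linarith)
    (by
      refine fun z => continuous_pi fun i => ?_
      exact continuous_const.mul (continuous_const.add ((continuous_apply _).comp (hg _ _))))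
    (by
      refine fun t z => (pi_norm_le_iff_of_nonneg (by positivity)).2 fun i => ?_
      rw [Real.coe_toNNReal _ (by positivity), Real.norm_eq_abs, abs_mul, hsabs, one_mul]
      exact (abs_add_le _ _).trans (add_le_add (abs_clamp_le hK.le _) (hbound _ _ _ _)))
    (fun t z => by ext i; simp only [F, hper])
    (fun t z i hi => by
      rw [hsF, clamp_of_ge (by linarith) hi]
      linarith [(abs_le.1 (hbound t (pos z) (vel z) (idx i))).1])
    (fun t z i hi => by
      rw [hsF, clamp_of_le (by linarith) hi]
      linarith [(abs_le.1 (hbound t (pos z) (vel z) (idx i))).2])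
  have hzi : ∀ i t, HasDerivAt (fun t => z t i) (F t (z t) i) t := fun i t =>
    hasDerivAt_pi.1 (hz t) i
  have hzc : ∀ i, Continuous fun t => z t i := fun i =>
    continuous_iff_continuousAt.2 fun t => (hzi i t).continuousAt
  have hcrit : ∀ i t, F t (z t) i = 0 → |z t i| ≤ K := by
    intro i t h
    have h1 := hsF t (z t) i
    rw [h, mul_zero] at h1
    have h2 := abs_le.1 (hbound t (pos (z t)) (vel (z t)) (idx i))
    refine abs_le.2 ⟨?_, ?_⟩ <;> by_contra! h3
    · rw [clamp_of_le (by linarith) h3.le] at h1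
      linarith
    · rw [clamp_of_ge (by linarith) h3.le] at h1
      linarith
  -- The derivative vanishes at the extrema of a periodic coordinate, which `hcrit` confines to
  -- `[-K, K]`; the clamp is inactive.
  have hzK : ∀ i t, |z t i| ≤ K := by
    intro i t
    have hp : Function.Periodic (fun t => z t i) T := fun t => congrFun (hzper t) i
    obtain ⟨a, ha⟩ := hp.exists_forall_le hT (hzc i)
    obtain ⟨b, hb⟩ := Function.Periodic.exists_forall_le (f := fun t => -z t i)
      (fun t => congrArg Neg.neg (hp t)) hT (hzc i).neg
    have h1 := hcrit i a (IsLocalMax.hasDerivAt_eq_zero (.of_forall ha) (hzi i a))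
    have h2 := hcrit i b (neg_eq_zero.1
      (IsLocalMax.hasDerivAt_eq_zero (.of_forall hb) (hzi i b).neg))
    exact abs_le.2 ⟨by linarith [hb t, (abs_le.1 h2).1], (ha t).trans (abs_le.1 h1).2⟩
  have hFz : ∀ t i, F t (z t) i = s i * (z t i + g t (pos (z t)) (vel (z t)) (idx i)) :=
    fun t i => by
      simp only [F]
      rw [clamp_of_mem (abs_le.1 (hzK i t)).1 (abs_le.1 (hzK i t)).2]
  refine ⟨fun t => pos (z t), fun t => vel (z t), fun t => by simp only [hzper t],
    fun t i => ?_, fun t i => ?_⟩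
  · convert! ((hzi (.inl i) t).add (hzi (.inr i) t)).div_const 2 using 1
    rw [hFz, hFz]
    simp only [s, idx, vel, Sum.elim_inl, Sum.elim_inr, id]
    ring
  · convert! ((hzi (.inl i) t).sub (hzi (.inr i) t)).div_const 2 using 1
    rw [hFz, hFz]
    simp only [s, idx, pos, vel, Sum.elim_inl, Sum.elim_inr, id]
    ring

/-! ### Bounds on the vector field. -/

/-- Converts between the sup metric of the existence theorem for second order systems and the
Euclidean metric of `v`. -/
lemma EuclideanSpace.dist_toLp_le {ι : Type*} [Fintype ι] (x y : ι → ℝ) :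
    dist (WithLp.toLp 2 x) (WithLp.toLp 2 y) ≤ √(Fintype.card ι) * dist x y := by
  rw [dist_eq_norm, ← WithLp.toLp_sub]
  exact EuclideanSpace.norm_le_sqrt_card_mul dist_nonneg fun i => dist_le_pi_dist x y i

lemma EuclideanSpace.abs_apply_le {ι : Type*} [Fintype ι] (x : EuclideanSpace ℝ ι) (i : ι) :
    |x i| ≤ ‖x‖ := PiLp.norm_apply_le x i

/-- Functions of subquadratic growth are small compared with `R ^ 2`. -/
lemma exists_add_mul_rpow_lt_sq (A B e R₀ : ℝ) (he : e < 2) :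
    ∃ R, R₀ < R ∧ A + B * R ^ e < R ^ 2 := by
  have h1 : Filter.Tendsto (fun R : ℝ => A * R ^ (-(2 : ℝ)) + B * R ^ (-(2 - e))) Filter.atTop
      (nhds (A * 0 + B * 0)) :=
    ((tendsto_rpow_neg_atTop two_pos).const_mul A).add
      ((tendsto_rpow_neg_atTop (sub_pos.2 he)).const_mul B)
  have h2 := h1.eventually (gt_mem_nhds (show A * 0 + B * 0 < 1 by norm_num))
  obtain ⟨R, hR, hRR, hR0⟩ := (h2.and ((Filter.eventually_gt_atTop R₀).and
    (Filter.eventually_gt_atTop 0))).exists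
  refine ⟨R, hRR, ?_⟩
  have h3 : R ^ (-(2 : ℝ)) = 1 / R ^ 2 := by
    rw [Real.rpow_neg hR0.le, Real.rpow_two, one_div]
  have h4 : R ^ (-(2 - e)) = R ^ e / R ^ 2 := by
    rw [neg_sub, Real.rpow_sub hR0, Real.rpow_two]
  rw [h3, h4, mul_one_div, ← mul_div_assoc, ← add_div, div_lt_one (by positivity)] at hR
  exact hR

section

variable {n : ℕ} {T : ℝ}
  {v : ℝ → EuclideanSpace ℝ (Fin n) → EuclideanSpace ℝ (Fin n) → EuclideanSpace ℝ (Fin n)}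

/-- A periodic vector field is bounded on bounded sets. -/
lemma exists_norm_le_of_periodic (hT : 0 < T)
    (hv : Continuous
      (fun p : ℝ × EuclideanSpace ℝ (Fin n) × EuclideanSpace ℝ (Fin n) => v p.1 p.2.1 p.2.2))
    (hv_per : ∀ t x y, v (t + T) x y = v t x y) (r : ℝ) :
    ∃ D, ∀ t x y, ‖x‖ ≤ r → ‖y‖ ≤ r → ‖v t x y‖ ≤ D := by
  obtain ⟨D, hD⟩ := (isCompact_Icc.prod ((isCompact_closedBall (0 : EuclideanSpace ℝ (Fin n)) r).prod
    (isCompact_closedBall (0 : EuclideanSpace ℝ (Fin n)) r))).exists_bound_of_continuousOn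
      (s := Set.Icc 0 T ×ˢ _) hv.continuousOn
  refine ⟨D, fun t x y hx hy => ?_⟩
  have hp : Function.Periodic v T := fun t => by ext1 x; ext1 y; exact hv_per t x y
  obtain ⟨s, hs, h⟩ := hp.exists_mem_Ico₀ hT t
  rw [h]
  exact hD (s, x, y) ⟨Set.Ico_subset_Icc_self hs, mem_closedBall_zero_iff.2 hx,
    mem_closedBall_zero_iff.2 hy⟩

/-- A periodic `C¹` vector field is Lipschitz on bounded sets. -/
lemma exists_dist_le_of_periodic (hT : 0 < T)
    (hv : ContDiff ℝ 1
      (fun p : ℝ × EuclideanSpace ℝ (Fin n) × EuclideanSpace ℝ (Fin n) => v p.1 p.2.1 p.2.2))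
    (hv_per : ∀ t x y, v (t + T) x y = v t x y) (r : ℝ) :
    ∃ L : NNReal, ∀ t x x' y y', ‖x‖ ≤ r → ‖x'‖ ≤ r → ‖y‖ ≤ r → ‖y'‖ ≤ r →
      dist (v t x y) (v t x' y') ≤ L * max (dist x x') (dist y y') := by
  obtain ⟨L, hL⟩ := hv.locallyLipschitz.locallyLipschitzOn.exists_lipschitzOnWith_of_compact
    (s := Set.Icc 0 T ×ˢ _)
    (isCompact_Icc.prod ((isCompact_closedBall (0 : EuclideanSpace ℝ (Fin n)) r).prod
      (isCompact_closedBall (0 : EuclideanSpace ℝ (Fin n)) r)))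
  refine ⟨L, fun t x x' y y' hx hx' hy hy' => ?_⟩
  have hp : Function.Periodic v T := fun t => by ext1 x; ext1 y; exact hv_per t x y
  obtain ⟨s, hs, h⟩ := hp.exists_mem_Ico₀ hT t
  rw [h]
  have := hL.dist_le_mul (s, x, y) ⟨Set.Ico_subset_Icc_self hs, mem_closedBall_zero_iff.2 hx,
    mem_closedBall_zero_iff.2 hy⟩ (s, x', y') ⟨Set.Ico_subset_Icc_self hs,
      mem_closedBall_zero_iff.2 hx', mem_closedBall_zero_iff.2 hy'⟩
  simpa [Prod.dist_eq] using this

/-- Subquadratic growth in the velocity yields a truncation level `R` at which the bound `Q` on the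
vector field is small compared with `R ^ 2`. -/
lemma exists_truncation_level (hT : 0 < T)
    (hv : Continuous
      (fun p : ℝ × EuclideanSpace ℝ (Fin n) × EuclideanSpace ℝ (Fin n) => v p.1 p.2.1 p.2.2))
    (hv_per : ∀ t x y, v (t + T) x y = v t x y) {a b δ : ℝ} (hδ : 0 < δ)
    (hgrowth : ∀ t x y, y ≠ 0 → ‖v t x y‖ ≤ a + b * ‖y‖ ^ (2 - δ)) {M : ℝ} (hM : 0 ≤ M) :
    ∃ R Q : ℝ, M < R ∧ 0 < Q ∧ 8 * M * Q < R ^ 2 ∧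
      ∀ t x y, (∀ i, |x i| ≤ M) → (∀ i, |y i| ≤ R) → ∀ j, |v t x y j| ≤ Q := by
  set N : ℝ := √(Fintype.card (Fin n))
  have hN : 0 ≤ N := Real.sqrt_nonneg _
  obtain ⟨D, hD⟩ := exists_norm_le_of_periodic hT hv hv_per (max (N * M) 1)
  -- A nonnegative exponent makes the power monotone in `‖y‖`, also when `2 < δ`. The growth bound
  -- is used only for `‖y‖ > 1`; compactness covers the rest, including `y = 0`.
  set e : ℝ := max (2 - δ) 0
  have he : e < 2 := max_lt (by linarith) two_pos
  have he0 : 0 ≤ e := le_max_right _ _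
  obtain ⟨R, hMR, hR⟩ := exists_add_mul_rpow_lt_sq (8 * M * (|D| + |a| + 1))
    (8 * M * (|b| * (N + 1) ^ e)) e (max M 1) he
  have hR1 : 1 < R := (le_max_right _ _).trans_lt hMR
  have hR0 : 0 < R := by linarith
  refine ⟨R, |D| + |a| + 1 + |b| * ((N + 1) * R) ^ e, (le_max_left _ _).trans_lt hMR,
    by positivity, ?_, fun t x y hx hy j => (EuclideanSpace.abs_apply_le _ j).trans ?_⟩
  · rw [Real.mul_rpow (by positivity) hR0.le]
    linarith
  · have hb : 0 ≤ |b| * ((N + 1) * R) ^ e := by positivity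
    rcases le_or_gt ‖y‖ 1 with h | h
    · have h1 := hD t x y ((EuclideanSpace.norm_le_sqrt_card_mul hM hx).trans (le_max_left _ _))
        (h.trans (le_max_right _ _))
      linarith [le_abs_self D, abs_nonneg a]
    · have hy0 : y ≠ 0 := norm_pos_iff.1 (one_pos.trans h)
      have hyR : ‖y‖ ≤ (N + 1) * R :=
        (EuclideanSpace.norm_le_sqrt_card_mul hR0.le hy).trans (by gcongr; linarith)
      have h1 : ‖y‖ ^ (2 - δ) ≤ ((N + 1) * R) ^ e :=
        (Real.rpow_le_rpow_of_exponent_le h.le (le_max_left _ _)).trans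
          (Real.rpow_le_rpow (norm_nonneg _) hyR he0)
      have h2 : b * ‖y‖ ^ (2 - δ) ≤ |b| * ((N + 1) * R) ^ e :=
        mul_le_mul (le_abs_self b) h1 (Real.rpow_nonneg (norm_nonneg _) _) (abs_nonneg b)
      linarith [hgrowth t x y hy0, le_abs_self a, abs_nonneg D]

end

/-! ### The truncated system and removal of the truncations. -/

theorem theorem3p3 (n : ℕ) (T : ℝ) (hT : 0 < T)
    (v : ℝ → EuclideanSpace ℝ (Fin n) → EuclideanSpace ℝ (Fin n) → EuclideanSpace ℝ (Fin n))
    (hv_smooth : ContDiff ℝ ∞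
      (fun p : ℝ × EuclideanSpace ℝ (Fin n) × EuclideanSpace ℝ (Fin n) => v p.1 p.2.1 p.2.2))
    (hv_per : ∀ t x y, v (t + T) x y = v t x y)
    -- `x₁ j` and `x₂ j` are the lower and the upper bounding function of the `j`-th coordinate
    (x₁ x₂ : Fin n → ℝ → ℝ)
    (hx₁_smooth : ∀ j, ContDiff ℝ ∞ (x₁ j)) (hx₂_smooth : ∀ j, ContDiff ℝ ∞ (x₂ j))
    (hx₁_per : ∀ j, Function.Periodic (x₁ j) T) (hx₂_per : ∀ j, Function.Periodic (x₂ j) T)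
    (hlt : ∀ j t, x₁ j t < x₂ j t)
    (hlower : ∀ (j : Fin n) (t : ℝ) (x y : EuclideanSpace ℝ (Fin n)),
      (∀ i, x i ∈ Set.Icc (x₁ i t) (x₂ i t)) → x j = x₁ j t → y j = deriv (x₁ j) t →
        v t x y j < deriv (deriv (x₁ j)) t)
    (hupper : ∀ (j : Fin n) (t : ℝ) (x y : EuclideanSpace ℝ (Fin n)),
      (∀ i, x i ∈ Set.Icc (x₁ i t) (x₂ i t)) → x j = x₂ j t → y j = deriv (x₂ j) t →
        deriv (deriv (x₂ j)) t < v t x y j)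
    -- the bound at `y = 0` follows by continuity if `δ ≤ 2` and is no restriction if `2 < δ`
    (a b δ : ℝ) (hδ : 0 < δ)
    (hgrowth : ∀ t x y, y ≠ 0 → ‖v t x y‖ ≤ a + b * ‖y‖ ^ (2 - δ)) :
    ∃ x : ℝ → EuclideanSpace ℝ (Fin n),
      IsSecondOrderSolution v x ∧ Function.Periodic x T ∧
        ∀ j t, x₁ j t < x t j ∧ x t j < x₂ j t := by
  have hderiv : ∀ f : ℝ → ℝ, ContDiff ℝ ∞ f →
      (∀ t, HasDerivAt f (deriv f t) t) ∧ ∀ t, HasDerivAt (deriv f) (deriv (deriv f) t) t := by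
    intro f hf
    have hf1 : ContDiff ℝ ∞ (deriv f) := (contDiff_infty_iff_deriv.1 hf).2
    exact ⟨fun t => (hf.differentiable (by simp) t).hasDerivAt,
      fun t => (hf1.differentiable (by simp) t).hasDerivAt⟩
  have hd₁ := fun j => hderiv _ (hx₁_smooth j)
  have hd₂ := fun j => hderiv _ (hx₂_smooth j)
  have hc : ∀ f : ℝ → ℝ, (∀ t, HasDerivAt f (deriv f t) t) → Continuous f := fun f hf =>
    continuous_iff_continuousAt.2 fun t => (hf t).continuousAt
  have hc' : ∀ f : ℝ → ℝ, (∀ t, HasDerivAt (deriv f) (deriv (deriv f) t) t) →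
      Continuous (deriv f) := fun f hf =>
    continuous_iff_continuousAt.2 fun t => (hf t).continuousAt
  -- `M` also bounds the velocities of `x₁` and `x₂`, so truncation at `R > M` leaves them unchanged
  -- where they are compared with the solution.
  obtain ⟨M, hM0, hM₁, hM₂, hM₁', hM₂'⟩ : ∃ M, 0 ≤ M ∧ (∀ j t, |x₁ j t| ≤ M) ∧
      (∀ j t, |x₂ j t| ≤ M) ∧ (∀ j t, |deriv (x₁ j) t| ≤ M) ∧ ∀ j t, |deriv (x₂ j) t| ≤ M := by
    obtain ⟨A, hA⟩ := exists_forall_abs_le_of_periodic hT hx₁_per fun j => hc _ (hd₁ j).1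
    obtain ⟨B, hB⟩ := exists_forall_abs_le_of_periodic hT hx₂_per fun j => hc _ (hd₂ j).1
    obtain ⟨C, hC⟩ := exists_forall_abs_le_of_periodic hT
      (fun j => deriv_periodic (hx₁_per j)) fun j => hc' _ (hd₁ j).2
    obtain ⟨D, hD⟩ := exists_forall_abs_le_of_periodic hT
      (fun j => deriv_periodic (hx₂_per j)) fun j => hc' _ (hd₂ j).2
    refine ⟨|A| + |B| + |C| + |D|, by positivity, fun j t => (hA j t).trans ?_,
      fun j t => (hB j t).trans ?_, fun j t => (hC j t).trans ?_, fun j t => (hD j t).trans ?_⟩ <;>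
    linarith [le_abs_self A, le_abs_self B, le_abs_self C, le_abs_self D, abs_nonneg A,
      abs_nonneg B, abs_nonneg C, abs_nonneg D]
  obtain ⟨R, Q, hMR, hQ, hQR, hvQ⟩ :=
    exists_truncation_level hT hv_smooth.continuous hv_per hδ hgrowth hM0
  have hR : 0 < R := hM0.trans_lt hMR
  let π : ℝ → (Fin n → ℝ) → Fin n → ℝ := fun t x i => clamp (x₁ i t) (x₂ i t) (x i)
  let κ : (Fin n → ℝ) → Fin n → ℝ := fun y i => clamp (-R) R (y i)
  have hπmem : ∀ t x i, π t x i ∈ Set.Icc (x₁ i t) (x₂ i t) := fun t x i =>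
    ⟨le_clamp _ _ _, clamp_le (hlt i t).le _⟩
  have hπM : ∀ t x i, |π t x i| ≤ M := fun t x i =>
    abs_clamp_le_of_abs_le (hlt i t).le (hM₁ i t) (hM₂ i t) _
  have hκR : ∀ y i, |κ y i| ≤ R := fun y i => abs_clamp_le hR.le _
  let w : ℝ → (Fin n → ℝ) → (Fin n → ℝ) → EuclideanSpace ℝ (Fin n) := fun t x y =>
    v t (WithLp.toLp 2 (π t x)) (WithLp.toLp 2 (κ y))
  have hw : ∀ t x y j, |w t x y j| ≤ Q := fun t x y => hvQ t _ _ (hπM t x) (hκR y)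
  set N : ℝ := √(Fintype.card (Fin n))
  have hN : 0 ≤ N := Real.sqrt_nonneg _
  obtain ⟨L, hL⟩ := exists_dist_le_of_periodic hT (hv_smooth.of_le (by simp)) hv_per (N * R)
  obtain ⟨x, y, hxper, hx, hy⟩ := exists_periodic_solution_second_order
    (g := fun t x y i => w t x y i - π t x i) (L := (L * N.toNNReal + 1)) (M := Q + M) hT
    (by positivity)
    (by
      intro t x x' y y'
      refine (dist_pi_le_iff (by positivity)).2 fun i => ?_
      have hπn : ∀ x, ‖WithLp.toLp 2 (π t x)‖ ≤ N * R := fun x =>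
        EuclideanSpace.norm_le_sqrt_card_mul hR.le fun i => (hπM t x i).trans hMR.le
      have hκn : ∀ y, ‖WithLp.toLp 2 (κ y)‖ ≤ N * R := fun y =>
        EuclideanSpace.norm_le_sqrt_card_mul hR.le (hκR y)
      have hπd : dist (π t x) (π t x') ≤ dist x x' := dist_pi_clamp_le _ _ _ _
      have hκd : dist (κ y) (κ y') ≤ dist y y' := dist_pi_clamp_le _ _ _ _
      have h1 : |w t x y i - w t x' y' i| ≤ L * (N * max (dist x x') (dist y y')) := by
        have h := hL t _ _ _ _ (hπn x) (hπn x') (hκn y) (hκn y')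
        rw [dist_eq_norm] at h
        refine (EuclideanSpace.abs_apply_le (w t x y - w t x' y') i).trans (h.trans ?_)
        gcongr
        refine max_le ((EuclideanSpace.dist_toLp_le _ _).trans ?_)
          ((EuclideanSpace.dist_toLp_le _ _).trans ?_)
        · exact mul_le_mul_of_nonneg_left (hπd.trans (le_max_left _ _)) hN
        · exact mul_le_mul_of_nonneg_left (hκd.trans (le_max_right _ _)) hN
      have h2 : |π t x i - π t x' i| ≤ max (dist x x') (dist y y') :=
        (dist_le_pi_dist _ _ i).trans (hπd.trans (le_max_left _ _))
      rw [Real.dist_eq, sub_sub_sub_comm]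
      refine (abs_sub _ _).trans ?_
      push_cast
      rw [Real.coe_toNNReal _ hN]
      linarith)
    (by
      intro x y
      have hπc : Continuous fun t => π t x := continuous_pi fun i =>
        (hc _ (hd₁ i).1).max ((hc _ (hd₂ i).1).min continuous_const)
      have hwc : Continuous fun t => w t x y := hv_smooth.continuous.comp
        (f := fun t => (t, WithLp.toLp 2 (π t x), WithLp.toLp 2 (κ y))) (by fun_prop)
      fun_prop)
    (fun t x y i => (abs_sub _ _).trans (add_le_add (hw t x y i) (hπM t x i)))
    (by
      intro t x y
      have hπT : π (t + T) x = π t x := by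
        ext i; simp only [π, hx₁_per i t, hx₂_per i t]
      simp only [w, hπT, hv_per])
  have hxi : ∀ i, Function.Periodic (fun t => x t i) T := fun i t => congrFun (hxper t) i
  have hκeq : ∀ t i, |y t i| ≤ R → κ (y t) i = y t i := fun t i h =>
    clamp_of_mem (abs_le.1 h).1 (abs_le.1 h).2
  have hbelow : ∀ j t, x t j - x₂ j t < 0 := by
    intro j
    -- Where `x j ≥ x₂ j` with equal velocities, the second derivative of the difference is `(x j -
    -- x₂ j) + (w j - x₂'' j)`: the first term is nonnegative, the second positive by `hupper`. The
    -- other velocities are truncated, which is harmless as `hupper` leaves them arbitrary.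
    refine neg_of_second_deriv_pos hT (fun t => (hx t j).sub ((hd₂ j).1 t))
      (fun t => (hy t j).sub ((hd₂ j).2 t)) ((hxi j).sub (hx₂_per j)) fun t h0 h1 => ?_
    have hπj : π t (x t) j = x₂ j t := clamp_of_ge (hlt j t).le (by linarith)
    have hyj : y t j = deriv (x₂ j) t := by linarith
    have := hupper j t (WithLp.toLp 2 (π t (x t))) (WithLp.toLp 2 (κ (y t))) (hπmem t (x t)) hπj
      (by rw [← hyj]; exact hκeq t j (by rw [hyj]; exact (hM₂' j t).trans hMR.le))
    simp only [w]
    linarith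
  have habove : ∀ j t, x₁ j t - x t j < 0 := by
    intro j
    refine neg_of_second_deriv_pos hT (fun t => ((hd₁ j).1 t).sub (hx t j))
      (fun t => ((hd₁ j).2 t).sub (hy t j)) ((hx₁_per j).sub (hxi j)) fun t h0 h1 => ?_
    have hπj : π t (x t) j = x₁ j t := clamp_of_le (hlt j t).le (by linarith)
    have hyj : y t j = deriv (x₁ j) t := by linarith
    have := hlower j t (WithLp.toLp 2 (π t (x t))) (WithLp.toLp 2 (κ (y t))) (hπmem t (x t)) hπj
      (by rw [← hyj]; exact hκeq t j (by rw [hyj]; exact (hM₁' j t).trans hMR.le))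
    simp only [w]
    linarith
  have hπx : ∀ t, π t (x t) = x t := fun t => funext fun i =>
    clamp_of_mem (by linarith [habove i t]) (by linarith [hbelow i t])
  have hxM : ∀ i t, |x t i| ≤ M := fun i t => by
    rw [← hπx t]; exact hπM t _ i
  have hyR : ∀ i t, |y t i| ≤ R := by
    intro i t
    refine abs_le_of_sq_le_sq ?_ hR.le
    -- With the position clamp inactive, `x'' = w`, which is bounded by `Q` whether or not the
    -- velocity is truncated.
    refine (sq_deriv_le_of_abs_le hQ (fun t => hx t i) (fun t => hy t i) (hxM i)
      (fun t => ?_) t).trans hQR.le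
    simp only [hπx, add_sub_cancel]
    exact hw _ _ _ _
  have hwx : ∀ t, w t (x t) (y t) = v t (WithLp.toLp 2 (x t)) (WithLp.toLp 2 (y t)) := fun t => by
    have hκy : κ (y t) = y t := funext fun i => hκeq t i (hyR i t)
    simp only [w, hπx, hκy]
  have hlift : ∀ (f : ℝ → Fin n → ℝ) (f' : EuclideanSpace ℝ (Fin n)) (t : ℝ),
      (∀ i, HasDerivAt (fun t => f t i) (f' i) t) →
        HasDerivAt (fun t => WithLp.toLp 2 (f t)) f' t := fun f f' t h =>
    (PiLp.continuousLinearEquiv 2 ℝ fun _ : Fin n => ℝ).symm.hasFDerivAt.comp_hasDerivAt t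
      (hasDerivAt_pi.2 h)
  have hX : ∀ t, HasDerivAt (fun t => WithLp.toLp 2 (x t)) (WithLp.toLp 2 (y t)) t := fun t =>
    hlift _ _ _ (hx t)
  have hXd : deriv (fun t => WithLp.toLp 2 (x t)) = fun t => WithLp.toLp 2 (y t) :=
    funext fun t => (hX t).deriv
  refine ⟨fun t => WithLp.toLp 2 (x t), fun t => ⟨(hX t).differentiableAt, ?_⟩,
    fun t => by simp only [hxper t],
    fun j t => ⟨by simpa using habove j t, by simpa using hbelow j t⟩⟩
  rw [hXd]
  refine hlift _ _ _ fun i => ?_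
  have := hy t i
  simpa only [hπx, hwx, add_sub_cancel] using this
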